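/- Let $|\phi\rangle\in\mathcal H_A\otimes\mathcal H_B$ be a unit vector, where $\mathcal H_A,\mathcal H_B$ are finite-dimensional Hilbert spaces, let $\phi_{AB}=|\phi\rangle\langle\phi|$ and $\rho_A=\operatorname{Tr}_B\phi_{AB}$, and let $\varepsilon\ge 0$. All logarithms are to base $2$. Let $F(\rho,\sigma)=\operatorname{Tr}\sqrt{\sqrt\rho\,\sigma\sqrt\rho}$ be the fidelity, let $S_{\min}(\rho)=-\log\lambda_{\max}(\rho)$, where $\lambda_{\max}(\rho)$ is the largest eigenvalue of $\rho$, and for $\delta\ge 0$ let $$S^{\delta}_{\min}(\rho)=\max\bigl\{S_{\min}(\sigma):\ \sigma\ge 0,\ \operatorname{Tr}\sigma=1,\ F^2(\rho,\sigma)\ge 1-\delta^2\bigr\}.$$ A maximally entangled state of rank $M$ is a vector $|\Psi^M\rangle=\frac1{\sqrt M}\sum_{i=1}^{M}|e_i\rangle\otimes|f_i\rangle$ in $\mathcal H_{A'}\otimes\mathcal H_{B'}$, where $(e_i)$ and $(f_i)$ are orthonormal bases of the spaces $\mathcal H_{A'},\mathcal H_{B'}$ of a common dimension $d\ge M$. A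 real number $R\ge 0$ is an $\varepsilon$-achievable rate for $\phi_{AB}$ if there are an integer $M\ge 2^R$, a maximally entangled state $\Psi^M_{A'B'}$ of rank $M$ and an LOCC operation (local operations and finitely many rounds of two-way classical communication) $\Lambda:AB\to A'B'$ with $F^2(\Lambda(\phi_{AB}),\Psi^M_{A'B'})\ge 1-\varepsilon$. The one-shot distillable entanglement $E_D(\phi_{AB};\varepsilon)\in[0,\infty]$ is the supremum of the $\varepsilon$-achievable rates. Theorem. The maximum in the definition of $S^\delta_{\min}(\rho_A)$ exists for every $\delta\ge0$, and if $\varepsilon<1$, then $E_D(\phi_{AB};\varepsilon)$ is finite and is the maximum of the $\varepsilon$-achievable rates. For every $\varepsilon\ge 0$, $$S_{\min}^{\varepsilon}(\rho_A)-\Delta\ \le\ E_D(\phi_{AB};\varepsilon),$$ where $\Delta$ is the least number $\ge 0$ such that $S_{\min}^{\varepsilon}(\rho_A)-\Delta$ is the logarithm of a positive integer; this number exists and satisfies $0\le\Delta\le 1$. If moreover $\varepsilon<\frac14$, then $$E_D(\phi_{AB};\varepsilon)\ \le\ S_{\min}^{\varepsilon'}(\rho_A)-\log\bigl(1-2\sqrt{\varepsilon}\bigr),\qquad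 \varepsilon'=\sqrt{2\sqrt{\varepsilon}}.$$ -/

import Mathlib

open scoped Kronecker MatrixOrder ComplexOrder

noncomputable section

namespace OneShot

/-- Operators on `ℂ^a ⊗ ℂ^b`. -/
abbrev BipOp (a b : ℕ) : Type := Matrix (Fin a × Fin b) (Fin a × Fin b) ℂ

/-- Vectors of `ℂ^a ⊗ ℂ^b`, with the Hilbert space norm. -/
abbrev BipVec (a b : ℕ) : Type := EuclideanSpace ℂ (Fin a × Fin b)

/-- The operator `|φ⟩⟨φ|`. -/
def proj {n : Type*} (φ : EuclideanSpace ℂ n) : Matrix n n ℂ :=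
  Matrix.vecMulVec φ.ofLp (star φ.ofLp)

/-- The partial trace over the second factor. -/
def traceB {a b : ℕ} (X : BipOp a b) : Matrix (Fin a) (Fin a) ℂ :=
  Matrix.of fun i j => ∑ k, X (i, k) (j, k)

/-- The fidelity `F(ρ, σ) = Tr √(√ρ σ √ρ)` of positive semidefinite matrices. -/
def fidelity {n : Type*} [Fintype n] [DecidableEq n] (ρ σ : Matrix n n ℂ) : ℝ :=
  (Matrix.trace (CFC.sqrt (CFC.sqrt ρ * σ * CFC.sqrt ρ))).re

/-- The largest eigenvalue of a Hermitian matrix. -/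
def lambdaMax {n : Type*} [Fintype n] [DecidableEq n] (ρ : Matrix n n ℂ) : ℝ :=
  sSup (spectrum ℝ ρ)

/-- The min-entropy `S_min(ρ) = - log₂ λ_max(ρ)`. -/
def minEntropy {n : Type*} [Fintype n] [DecidableEq n] (ρ : Matrix n n ℂ) : ℝ :=
  -Real.logb 2 (lambdaMax ρ)

/-- The `ε`-ball of normalized states around `ρ`. -/
def stateBall {n : Type*} [Fintype n] [DecidableEq n] (ρ : Matrix n n ℂ) (ε : ℝ) :
    Set (Matrix n n ℂ) :=
  {σ | σ.PosSemidef ∧ σ.trace = 1 ∧ 1 - ε ^ 2 ≤ fidelity ρ σ ^ 2}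

/-- The smoothed min-entropy, the maximum of `S_min` over the `ε`-ball around `ρ`. -/
def smoothMinEntropy {n : Type*} [Fintype n] [DecidableEq n] (ε : ℝ) (ρ : Matrix n n ℂ) : ℝ :=
  sSup (minEntropy '' stateBall ρ ε)

/-- The map `X ↦ K X K†`. -/
def conjBy {m n : Type*} [Fintype m] (K : Matrix n m ℂ) :
    Matrix m m ℂ →ₗ[ℂ] Matrix n n ℂ where
  toFun X := K * X * K.conjTranspose
  map_add' X Y := by rw [Matrix.mul_add, Matrix.add_mul]
  map_smul' c X := by simp

/-- The LOCC operations `AB → A'B'` with finitely many rounds. In a round one of the parties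
performs a local measurement with Kraus operators `K i` (`∑ i, K i† K i = 1`; the dimension of the
local system may change, and a single outcome gives a local isometry) and announces the outcome `i`,
after which an LOCC operation that may depend on `i` is carried out. The outcomes are discarded in
the end, whence the sum. -/
inductive IsLOCC {a' b' : ℕ} : {a b : ℕ} → (BipOp a b →ₗ[ℂ] BipOp a' b') → Prop
  | nil : IsLOCC (LinearMap.id : BipOp a' b' →ₗ[ℂ] BipOp a' b')
  | alice {a b a₁ n : ℕ} (K : Fin n → Matrix (Fin a₁) (Fin a) ℂ)
      (hK : ∑ i, (K i).conjTranspose * K i = 1)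
      (Λ : Fin n → (BipOp a₁ b →ₗ[ℂ] BipOp a' b')) (hΛ : ∀ i, IsLOCC (Λ i)) :
      IsLOCC (∑ i, Λ i ∘ₗ conjBy (K i ⊗ₖ (1 : Matrix (Fin b) (Fin b) ℂ)))
  | bob {a b b₁ n : ℕ} (K : Fin n → Matrix (Fin b₁) (Fin b) ℂ)
      (hK : ∑ i, (K i).conjTranspose * K i = 1)
      (Λ : Fin n → (BipOp a b₁ →ₗ[ℂ] BipOp a' b')) (hΛ : ∀ i, IsLOCC (Λ i)) :
      IsLOCC (∑ i, Λ i ∘ₗ conjBy ((1 : Matrix (Fin a) (Fin a) ℂ) ⊗ₖ K i))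

/-- `Ψ = (1/√M) ∑_{i < M} e i ⊗ f i` for orthonormal bases `e`, `f` of two spaces of
dimension `d ≥ M`. -/
def IsMaxEntangled {d : ℕ} (M : ℕ) (Ψ : BipVec d d) : Prop :=
  M ≤ d ∧ ∃ e f : OrthonormalBasis (Fin d) ℂ (EuclideanSpace ℂ (Fin d)),
    ∀ x y : Fin d, Ψ (x, y) =
      ((Real.sqrt M)⁻¹ : ℂ) * ∑ i : Fin d, if (i : ℕ) < M then e i x * f i y else 0

/-- `R` is an `ε`-achievable rate for one-shot entanglement distillation of `φ`. -/
def IsAchievableRate {a b : ℕ} (φ : BipVec a b) (ε R : ℝ) : Prop :=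
  0 ≤ R ∧ ∃ (M d : ℕ) (Ψ : BipVec d d) (Λ : BipOp a b →ₗ[ℂ] BipOp d d),
    (2 : ℝ) ^ R ≤ (M : ℝ) ∧ IsMaxEntangled M Ψ ∧ IsLOCC Λ ∧
      1 - ε ≤ fidelity (Λ (proj φ)) (proj Ψ) ^ 2

/-- The achievable rates, as extended real numbers. -/
def achievableRates {a b : ℕ} (φ : BipVec a b) (ε : ℝ) : Set EReal :=
  {r | ∃ R : ℝ, IsAchievableRate φ ε R ∧ r = (R : EReal)}

/-- The one-shot distillable entanglement: the supremum of the achievable rates (`⊤` if they are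
unbounded, which happens when `ε ≥ 1`). -/
def distillableEntanglement {a b : ℕ} (φ : BipVec a b) (ε : ℝ) : EReal :=
  sSup (achievableRates φ ε)

end OneShot

end

/-!
The vector `φ` is described by its coefficient matrix `X`, so that `ρ_A = X Xᴴ`; local operators act
by `X ↦ A X` and `X ↦ X Bᵀ`, and the largest eigenvalue of a positive semidefinite matrix is its
operator norm. Uhlmann's theorem is used in two halves: an overlap `Re Tr (X Yᴴ)` is at most
`F(X Xᴴ, Y Yᴴ)` (`re_trace_mul_conjTranspose_le_fidelity`), and the value `F(X Xᴴ, σ)` is attained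
as `Re Tr (√σ X W)` for a contraction `W` (`exists_trace_eq_fidelity`). Both rest on the polar
decomposition (`exists_polar`).

The maximum in the smoothed min-entropy exists because the ball is compact and the operator norm is
continuous (`isGreatest_smoothMinEntropy`).

*Upper bounds.* For an LOCC operation with Kraus operators `Kᵢ` and a target `Ψ` of rank `M`, the
vector `Y = ∑ Kᵢ† |Ψ⟩⟨Ψ| Kᵢ |φ⟩` has overlap `⟨Ψ|Λ(φ)|Ψ⟩ ≥ 1 - ε` with `φ`, its norm is at most `1`,
and its coefficient matrix has squared operator norm at most `1 / M`. These three properties are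
proved by induction on the protocol (`IsLOCC.exists_witness`); the step for the operator norm is the
least squares inequality `conjTranspose_mul_self_sum_le`. Normalizing `Y Yᴴ`, whose trace is at
least `(1 - ε)² ≥ 1 - 2 √ε`, gives a state close to `ρ_A` with largest eigenvalue at most
`1 / (M (1 - 2 √ε))` (`logb_rank_le_smoothMinEntropy`). Since the trace of `Y Yᴴ` is at most
`dim A / M`, the ranks `M` are bounded for `ε < 1`, so the supremum of the rates is attained.

*Lower bound.* Let `σ` be a maximizer in the ball and `N` the integer part of `1 / λ_max(σ)`. By
Birkhoff's theorem `σ` is a mixture of normalized projections of rank `N`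
(`exists_mixture_of_isometries`). This mixture turns into a measurement of Alice which would take a
purification of `σ` to a maximally entangled state of rank `N` with certainty. Applied to `φ`
instead, it reaches squared fidelity at least `F²(ρ_A, σ)`, by Jensen's inequality
(`isAchievableRate_logb`).
-/

namespace OneShot

open Matrix
open scoped Matrix.Norms.L2Operator

/-! ### Contractions, square roots and the polar decomposition -/

section Polar

variable {m n : Type*} [Fintype m] [Fintype n] [DecidableEq n]

lemma norm_le_one_iff_conjTranspose_mul_self_le (A : Matrix m n ℂ) : ‖A‖ ≤ 1 ↔ Aᴴ * A ≤ 1 := by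
  have h0 : (0 : Matrix n n ℂ) ≤ Aᴴ * A := (posSemidef_conjTranspose_mul_self A).nonneg
  rw [← CStarAlgebra.norm_le_one_iff_of_nonneg _ h0, l2_opNorm_conjTranspose_mul_self]
  constructor
  · intro h
    nlinarith [norm_nonneg A]
  · intro h
    nlinarith [norm_nonneg A]

/-- The pseudo-inverse of the square root of a positive semidefinite matrix. On the kernel it
vanishes, because `0⁻¹ = 0`. -/
noncomputable def invSqrt (P : Matrix n n ℂ) : Matrix n n ℂ := cfc (fun x : ℝ => (√x)⁻¹) P

lemma sqrt_eq_cfc_real {P : Matrix n n ℂ} (hP : P.PosSemidef) : CFC.sqrt P = cfc Real.sqrt P := by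
  rw [CFC.sqrt_eq_real_sqrt P hP.nonneg, cfcₙ_eq_cfc]

lemma continuousOn_spectrum (P : Matrix n n ℂ) (f : ℝ → ℝ) : ContinuousOn f (spectrum ℝ P) :=
  (Matrix.finite_real_spectrum (A := P)).continuousOn f

lemma invSqrt_posSemidef (P : Matrix n n ℂ) : (invSqrt P).PosSemidef := by
  rw [← nonneg_iff_posSemidef]
  exact cfc_nonneg fun x _ => by positivity

lemma mul_invSqrt {P : Matrix n n ℂ} (hP : P.PosSemidef) : P * invSqrt P = CFC.sqrt P := by
  rw [sqrt_eq_cfc_real hP, invSqrt]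
  nth_rw 1 [← cfc_id' ℝ P hP.isHermitian.isSelfAdjoint]
  rw [← cfc_mul _ _ _ (continuousOn_spectrum P _) (continuousOn_spectrum P _)]
  refine cfc_congr fun x hx => ?_
  have hx0 : 0 ≤ x := spectrum_nonneg_of_nonneg hP.nonneg hx
  simp only [← div_eq_mul_inv, Real.div_sqrt]

lemma invSqrt_mul_self {P : Matrix n n ℂ} (hP : P.PosSemidef) :
    invSqrt P * P = CFC.sqrt P := by
  have h := congrArg conjTranspose (mul_invSqrt hP)
  rwa [conjTranspose_mul, hP.isHermitian, (invSqrt_posSemidef _).isHermitian,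
    (CFC.sqrt_nonneg P).posSemidef.isHermitian] at h

/-- With `G` the pseudo-inverse of `√P`, the product `G P G` is the projection onto the support of
`P`. -/
lemma invSqrt_mul_self_mul_invSqrt_le {P : Matrix n n ℂ} (hP : P.PosSemidef) :
    invSqrt P * P * invSqrt P ≤ 1 := by
  rw [invSqrt_mul_self hP, sqrt_eq_cfc_real hP, invSqrt,
    ← cfc_mul _ _ _ (continuousOn_spectrum P _) (continuousOn_spectrum P _)]
  refine cfc_le_one _ _ fun x _ => ?_
  exact mul_inv_le_one

lemma mul_sqrt_mul_invSqrt {P : Matrix n n ℂ} (hP : P.PosSemidef) :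
    P * (invSqrt P * CFC.sqrt P) = P := by
  rw [← Matrix.mul_assoc, mul_invSqrt hP, CFC.sqrt_mul_sqrt_self P hP.nonneg]

/-- Polar decomposition, with the partial isometry described as a contraction. -/
lemma exists_polar (T : Matrix m n ℂ) :
    ∃ U : Matrix m n ℂ, ‖U‖ ≤ 1 ∧ U * CFC.sqrt (Tᴴ * T) = T ∧ Uᴴ * T = CFC.sqrt (Tᴴ * T) := by
  have hP := posSemidef_conjTranspose_mul_self T
  have hG := (invSqrt_posSemidef (Tᴴ * T)).isHermitian
  refine ⟨T * invSqrt (Tᴴ * T), ?_, ?_, ?_⟩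
  · rw [norm_le_one_iff_conjTranspose_mul_self_le, conjTranspose_mul, hG]
    simpa only [Matrix.mul_assoc] using invSqrt_mul_self_mul_invSqrt_le hP
  · rw [← sub_eq_zero, ← conjTranspose_mul_self_eq_zero]
    set Q := invSqrt (Tᴴ * T) * CFC.sqrt (Tᴴ * T) with hQ
    have h1 : Tᴴ * T * Q = Tᴴ * T := mul_sqrt_mul_invSqrt hP
    have h2 : T * invSqrt (Tᴴ * T) * CFC.sqrt (Tᴴ * T) - T = T * (Q - 1) := by
      rw [hQ, Matrix.mul_sub, Matrix.mul_one, Matrix.mul_assoc]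
    rw [h2, conjTranspose_mul, Matrix.mul_assoc, ← Matrix.mul_assoc Tᴴ, Matrix.mul_sub, h1,
      Matrix.mul_one, sub_self, Matrix.mul_zero]
  · rw [conjTranspose_mul, hG, Matrix.mul_assoc, invSqrt_mul_self hP]

end Polar

/-! ### Fidelity -/

section Fidelity

variable {m n : Type*} [Fintype m] [Fintype n] [DecidableEq n]

/-- The square root of `P` compresses `2 - C - Cᴴ = (1 - C)ᴴ (1 - C) + (1 - Cᴴ C) ≥ 0`. -/
lemma re_trace_mul_le_of_norm_le_one {C P : Matrix n n ℂ} (hC : ‖C‖ ≤ 1) (hP : P.PosSemidef) :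
    (C * P).trace.re ≤ P.trace.re := by
  have hpos : (2 - C - Cᴴ : Matrix n n ℂ).PosSemidef := by
    have h1 : (2 - C - Cᴴ : Matrix n n ℂ) = (1 - C)ᴴ * (1 - C) + (1 - Cᴴ * C) := by
      rw [conjTranspose_sub, conjTranspose_one, Matrix.sub_mul, Matrix.mul_sub, Matrix.mul_sub,
        ← one_add_one_eq_two]
      simp only [Matrix.one_mul, Matrix.mul_one]
      abel
    rw [h1]
    exact (posSemidef_conjTranspose_mul_self _).add
      (le_iff.mp ((norm_le_one_iff_conjTranspose_mul_self_le C).mp hC))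
  obtain ⟨S, rfl⟩ := CStarAlgebra.nonneg_iff_eq_star_mul_self.mp hP.nonneg
  have h2 := (hpos.mul_mul_conjTranspose_same S).trace_nonneg
  have h3 : (C * (star S * S)).trace = (S * C * Sᴴ).trace := by
    rw [star_eq_conjTranspose, ← Matrix.mul_assoc, trace_mul_comm, ← Matrix.mul_assoc]
  have h4 : (star S * S).trace = (S * Sᴴ).trace := by
    rw [star_eq_conjTranspose, trace_mul_comm]
  have h5 : (S * Cᴴ * Sᴴ).trace = star (S * C * Sᴴ).trace := by
    rw [← trace_conjTranspose]
    simp only [conjTranspose_mul, conjTranspose_conjTranspose, Matrix.mul_assoc]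
  have h6 : S * (2 - C - Cᴴ) * Sᴴ = S * Sᴴ + S * Sᴴ - S * C * Sᴴ - S * Cᴴ * Sᴴ := by
    rw [← one_add_one_eq_two]
    simp only [Matrix.mul_sub, Matrix.sub_mul, Matrix.mul_add, Matrix.add_mul, Matrix.mul_one]
  rw [h6, trace_sub, trace_sub, trace_add, h5] at h2
  rw [h3, h4]
  have h7 := (Complex.le_def.mp h2).1
  simp at h7
  linarith

/-- Duality of trace norm and operator norm. -/
lemma re_trace_mul_le_trace_sqrt {C : Matrix n n ℂ} (T : Matrix n n ℂ) (hC : ‖C‖ ≤ 1) :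
    (C * T).trace.re ≤ (CFC.sqrt (Tᴴ * T)).trace.re := by
  obtain ⟨U, hU, hUT, -⟩ := exists_polar T
  have hCU : ‖C * U‖ ≤ 1 :=
    (l2_opNorm_mul C U).trans (mul_le_one₀ hC (norm_nonneg _) hU)
  have h := re_trace_mul_le_of_norm_le_one hCU (CFC.sqrt_nonneg (Tᴴ * T)).posSemidef
  rwa [Matrix.mul_assoc, hUT] at h

lemma sqrt_mul_mul_sqrt_eq {ρ σ : Matrix n n ℂ} (hσ : σ.PosSemidef) :
    CFC.sqrt ρ * σ * CFC.sqrt ρ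
      = (CFC.sqrt σ * CFC.sqrt ρ)ᴴ * (CFC.sqrt σ * CFC.sqrt ρ) := by
  rw [conjTranspose_mul, (CFC.sqrt_nonneg ρ).posSemidef.isHermitian,
    (CFC.sqrt_nonneg σ).posSemidef.isHermitian, Matrix.mul_assoc, Matrix.mul_assoc,
    ← Matrix.mul_assoc (CFC.sqrt σ), CFC.sqrt_mul_sqrt_self σ hσ.nonneg]

/-- The easy half of Uhlmann's theorem: overlaps of purifications are at most the fidelity. -/
lemma re_trace_mul_conjTranspose_le_fidelity [DecidableEq m] (X Y : Matrix n m ℂ) :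
    (X * Yᴴ).trace.re ≤ fidelity (X * Xᴴ) (Y * Yᴴ) := by
  obtain ⟨U, hU, hUX, -⟩ := exists_polar Xᴴ
  obtain ⟨V, hV, hVY, -⟩ := exists_polar Yᴴ
  rw [conjTranspose_conjTranspose] at hUX hVY
  have hX : X = CFC.sqrt (X * Xᴴ) * Uᴴ := by
    have h := congrArg conjTranspose hUX
    rwa [conjTranspose_mul, (CFC.sqrt_nonneg (X * Xᴴ)).posSemidef.isHermitian,
      conjTranspose_conjTranspose, eq_comm] at h
  have hC : ‖Uᴴ * V‖ ≤ 1 := (l2_opNorm_mul _ _).trans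
    (mul_le_one₀ ((l2_opNorm_conjTranspose U).trans_le hU) (norm_nonneg _) hV)
  rw [fidelity, sqrt_mul_mul_sqrt_eq (posSemidef_self_mul_conjTranspose Y)]
  refine le_trans (le_of_eq ?_) (re_trace_mul_le_trace_sqrt _ hC)
  congr 1
  nth_rw 1 [← hVY]
  nth_rw 1 [hX]
  rw [Matrix.mul_assoc, trace_mul_comm]
  simp only [Matrix.mul_assoc]

/-- The hard half of Uhlmann's theorem. The second purification is `√σ W†`, with a contraction
in place of a partial isometry. -/
lemma exists_trace_eq_fidelity (X : Matrix n m ℂ) {σ : Matrix n n ℂ} (hσ : σ.PosSemidef) :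
    ∃ W : Matrix m n ℂ, ‖W‖ ≤ 1 ∧ (CFC.sqrt σ * X * W).trace.re = fidelity (X * Xᴴ) σ := by
  obtain ⟨V, hV, -, hVX⟩ := exists_polar Xᴴ
  obtain ⟨U, hU, -, hUT⟩ := exists_polar (CFC.sqrt σ * CFC.sqrt (X * Xᴴ))
  rw [conjTranspose_conjTranspose] at hVX
  have hX : X * V = CFC.sqrt (X * Xᴴ) := by
    have h := congrArg conjTranspose hVX
    rwa [conjTranspose_mul, conjTranspose_conjTranspose, conjTranspose_conjTranspose,
      (CFC.sqrt_nonneg (X * Xᴴ)).posSemidef.isHermitian] at h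
  refine ⟨V * Uᴴ, (l2_opNorm_mul _ _).trans
    (mul_le_one₀ hV (norm_nonneg _) ((l2_opNorm_conjTranspose U).trans_le hU)), ?_⟩
  rw [fidelity, sqrt_mul_mul_sqrt_eq hσ, ← hUT, ← hX, trace_mul_comm Uᴴ]
  simp only [Matrix.mul_assoc]

lemma fidelity_self {ρ : Matrix n n ℂ} (hρ : ρ.PosSemidef) : fidelity ρ ρ = ρ.trace.re := by
  have h : CFC.sqrt ρ * ρ * CFC.sqrt ρ = ρ * ρ := by
    have h0 := CFC.sqrt_mul_sqrt_self ρ hρ.nonneg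
    calc CFC.sqrt ρ * ρ * CFC.sqrt ρ
        = CFC.sqrt ρ * (CFC.sqrt ρ * CFC.sqrt ρ) * CFC.sqrt ρ := by rw [h0]
      _ = (CFC.sqrt ρ * CFC.sqrt ρ) * (CFC.sqrt ρ * CFC.sqrt ρ) := by
        simp only [Matrix.mul_assoc]
      _ = ρ * ρ := by rw [h0]
  rw [fidelity, h, CFC.sqrt_mul_self ρ hρ.nonneg]

/-- Since `√A |Ψ⟩⟨Ψ| √A` has rank one, its square root is a multiple of it. -/
lemma fidelity_proj_sq {A : Matrix n n ℂ} (hA : A.PosSemidef) (Ψ : EuclideanSpace ℂ n) :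
    fidelity A (proj Ψ) ^ 2 = (star Ψ.ofLp ⬝ᵥ A *ᵥ Ψ.ofLp).re := by
  have hS := (CFC.sqrt_nonneg A).posSemidef.isHermitian
  set v : n → ℂ := CFC.sqrt A *ᵥ Ψ.ofLp with hv
  have h1 : CFC.sqrt A * proj Ψ * CFC.sqrt A = vecMulVec v (star v) := by
    rw [proj, mul_vecMulVec, vecMulVec_mul, hv, star_mulVec, hS]
  have h2 : star v ⬝ᵥ v = star Ψ.ofLp ⬝ᵥ A *ᵥ Ψ.ofLp := by
    rw [hv, star_mulVec, hS, ← dotProduct_mulVec, mulVec_mulVec,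
      CFC.sqrt_mul_sqrt_self A hA.nonneg]
  rw [← h2]
  have h3 : (0 : ℂ) ≤ star v ⬝ᵥ v := dotProduct_star_self_nonneg v
  obtain ⟨r, hr0, hr⟩ : ∃ r : ℝ, 0 ≤ r ∧ star v ⬝ᵥ v = (r : ℂ) :=
    ⟨_, (Complex.le_def.mp h3).1, Complex.ext rfl (Complex.le_def.mp h3).2.symm⟩
  have h4 : CFC.sqrt (vecMulVec v (star v)) = ((√r)⁻¹ : ℝ) • vecMulVec v (star v) := by
    refine CFC.sqrt_unique ?_ ?_
    · rw [Matrix.smul_mul, Matrix.mul_smul, vecMulVec_mul_vecMulVec, hr, smul_smul]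
      rcases hr0.eq_or_lt with rfl | hr1
      · have : v = 0 := by simpa using hr
        simp [this]
      · have h5 : (√r)⁻¹ * (√r)⁻¹ * r = 1 := by
          rw [← mul_inv, Real.mul_self_sqrt hr0, inv_mul_cancel₀ hr1.ne']
        rw [vecMulVec_smul, ← Complex.coe_smul, smul_smul, ← Complex.ofReal_mul, h5,
          Complex.ofReal_one, one_smul]
    · exact smul_nonneg (by positivity) (posSemidef_vecMulVec_self_star v).nonneg
  rw [fidelity, h1, h4, trace_smul, trace_vecMulVec, dotProduct_comm, hr, Complex.smul_re,
    Complex.ofReal_re, smul_eq_mul, mul_pow, inv_pow, Real.sq_sqrt hr0]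
  rcases hr0.eq_or_lt with rfl | hr1
  · simp
  · field_simp

end Fidelity

/-! ### Smoothed min-entropy -/

section MinEntropy

variable {n : Type*} [Fintype n] [DecidableEq n]

lemma norm_mem_spectrum [Nonempty n] {σ : Matrix n n ℂ} (hσ : σ.PosSemidef) :
    ‖σ‖ ∈ spectrum ℝ σ :=
  CStarAlgebra.norm_mem_spectrum_of_nonneg hσ.nonneg

lemma lambdaMax_eq_norm {σ : Matrix n n ℂ} (hσ : σ.PosSemidef) : lambdaMax σ = ‖σ‖ := by
  rcases isEmpty_or_nonempty n with hn | hn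
  · have : σ = 0 := Subsingleton.elim _ _
    have h0 : spectrum ℝ σ = ∅ := spectrum.of_subsingleton σ
    rw [lambdaMax, h0, this, Real.sSup_empty, norm_zero]
  · refine IsGreatest.csSup_eq ⟨norm_mem_spectrum hσ, fun x hx => ?_⟩
    exact (Real.le_norm_self x).trans (spectrum.norm_le_norm_of_mem hx)

lemma norm_le_re_trace {σ : Matrix n n ℂ} (hσ : σ.PosSemidef) : ‖σ‖ ≤ σ.trace.re := by
  rcases isEmpty_or_nonempty n with hn | hn
  · have : σ = 0 := Subsingleton.elim _ _
    simp [this]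
  · obtain ⟨i, hi⟩ : ‖σ‖ ∈ Set.range hσ.isHermitian.eigenvalues :=
      hσ.isHermitian.spectrum_real_eq_range_eigenvalues ▸ norm_mem_spectrum hσ
    rw [← hi, hσ.isHermitian.trace_eq_sum_eigenvalues, Complex.re_sum]
    exact Finset.single_le_sum (f := hσ.isHermitian.eigenvalues)
      (fun j _ => hσ.eigenvalues_nonneg j) (Finset.mem_univ i)

lemma re_trace_le_card_mul_norm {σ : Matrix n n ℂ} (hσ : σ.PosSemidef) :
    σ.trace.re ≤ Fintype.card n * ‖σ‖ := by
  rcases isEmpty_or_nonempty n with hn | hn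
  · simp [Matrix.trace]
  · rw [hσ.isHermitian.trace_eq_sum_eigenvalues, Complex.re_sum, ← nsmul_eq_mul]
    refine Finset.sum_le_card_nsmul _ _ _ fun i _ => ?_
    exact (Real.le_norm_self _).trans
      (spectrum.norm_le_norm_of_mem (hσ.isHermitian.eigenvalues_mem_spectrum_real i))

lemma norm_pos_of_trace_eq_one {σ : Matrix n n ℂ} (h : σ.trace = 1) : 0 < ‖σ‖ := by
  rw [norm_pos_iff]
  rintro rfl
  simp at h

lemma minEntropy_eq {σ : Matrix n n ℂ} (hσ : σ.PosSemidef) :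
    minEntropy σ = -Real.logb 2 ‖σ‖ := by
  rw [minEntropy, lambdaMax_eq_norm hσ]

lemma self_mem_stateBall {ρ : Matrix n n ℂ} (hρ : ρ.PosSemidef) (h1 : ρ.trace = 1) (δ : ℝ) :
    ρ ∈ stateBall ρ δ := by
  refine ⟨hρ, h1, ?_⟩
  rw [fidelity_self hρ, h1, Complex.one_re]
  nlinarith [sq_nonneg δ]

lemma isCompact_stateBall (ρ : Matrix n n ℂ) (δ : ℝ) : IsCompact (stateBall ρ δ) := by
  have : ProperSpace (Matrix n n ℂ) := FiniteDimensional.proper ℂ _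
  have hfid : ContinuousOn (fun σ => fidelity ρ σ ^ 2) {σ : Matrix n n ℂ | 0 ≤ σ} := by
    refine ContinuousOn.pow (Complex.continuous_re.comp_continuousOn
      (continuous_id.matrix_trace.comp_continuousOn ?_)) 2
    refine CFC.continuousOn_sqrt.comp (by fun_prop) fun σ hσ => ?_
    have h := (nonneg_iff_posSemidef.mp hσ).mul_mul_conjTranspose_same (CFC.sqrt ρ)
    rw [(CFC.sqrt_nonneg ρ).posSemidef.isHermitian] at h
    exact h.nonneg
  have hclosed : IsClosed (stateBall ρ δ) := by
    have h1 := hfid.preimage_isClosed_of_isClosed CStarAlgebra.isClosed_nonneg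
      (isClosed_Ici (a := 1 - δ ^ 2))
    have h2 : IsClosed {σ : Matrix n n ℂ | σ.trace = 1} :=
      isClosed_eq continuous_id.matrix_trace continuous_const
    convert h2.inter h1 using 1
    ext σ
    simp only [stateBall, Set.mem_ofPred_eq, Set.mem_inter_iff, Set.mem_preimage, Set.mem_Ici,
      nonneg_iff_posSemidef]
    tauto
  refine (isCompact_closedBall (0 : Matrix n n ℂ) 1).of_isClosed_subset hclosed fun σ hσ => ?_
  rw [mem_closedBall_zero_iff]
  exact (norm_le_re_trace hσ.1).trans (by rw [hσ.2.1, Complex.one_re])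

/-- The minimum of the operator norm over the compact set `stateBall ρ δ` is attained. -/
lemma isGreatest_smoothMinEntropy {ρ : Matrix n n ℂ} (hρ : ρ.PosSemidef) (h1 : ρ.trace = 1)
    (δ : ℝ) : IsGreatest (minEntropy '' stateBall ρ δ) (smoothMinEntropy δ ρ) := by
  obtain ⟨σ, hσ, hmin⟩ := (isCompact_stateBall ρ δ).exists_isMinOn
    ⟨ρ, self_mem_stateBall hρ h1 δ⟩ continuous_norm.continuousOn
  have h : IsGreatest (minEntropy '' stateBall ρ δ) (minEntropy σ) := by
    refine ⟨⟨σ, hσ, rfl⟩, ?_⟩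
    rintro _ ⟨τ, hτ, rfl⟩
    rw [minEntropy_eq hσ.1, minEntropy_eq hτ.1, neg_le_neg_iff]
    exact Real.logb_le_logb_of_le one_lt_two (norm_pos_of_trace_eq_one hσ.2.1) (hmin hτ)
  rw [smoothMinEntropy, h.csSup_eq]
  exact h

end MinEntropy

/-! ### Coefficient matrices of bipartite vectors -/

section Bipartite

variable {a b c d : ℕ}

/-- The vector `∑ X i k |i⟩|k⟩` of `ℂ^a ⊗ ℂ^b` with coefficient matrix `X`. -/
def bipVec (X : Matrix (Fin a) (Fin b) ℂ) : Fin a × Fin b → ℂ := fun p => X p.1 p.2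

/-- The coefficient matrix of a vector of `ℂ^a ⊗ ℂ^b`. -/
def coeffMatrix (φ : BipVec a b) : Matrix (Fin a) (Fin b) ℂ := Matrix.of fun i k => φ (i, k)

lemma bipVec_coeffMatrix (φ : BipVec a b) : bipVec (coeffMatrix φ) = φ.ofLp := rfl

lemma traceB_proj (φ : BipVec a b) :
    traceB (proj φ) = coeffMatrix φ * (coeffMatrix φ)ᴴ := by
  ext i j
  simp [traceB, proj, coeffMatrix, vecMulVec_apply, Matrix.mul_apply]

lemma star_bipVec_dotProduct (P X : Matrix (Fin a) (Fin b) ℂ) :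
    star (bipVec P) ⬝ᵥ bipVec X = (X * Pᴴ).trace := by
  simp only [dotProduct, bipVec, Fintype.sum_prod_type, Matrix.trace, Matrix.diag_apply,
    Matrix.mul_apply, Pi.star_apply, conjTranspose_apply]
  exact Finset.sum_congr rfl fun i _ => Finset.sum_congr rfl fun k _ => mul_comm _ _

lemma kronecker_one_mulVec_bipVec (K : Matrix (Fin c) (Fin a) ℂ) (X : Matrix (Fin a) (Fin b) ℂ) :
    (K ⊗ₖ (1 : Matrix (Fin b) (Fin b) ℂ)) *ᵥ bipVec X = bipVec (K * X) := by
  ext ⟨i, k⟩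
  simp [mulVec, dotProduct, bipVec, Fintype.sum_prod_type, Matrix.mul_apply, Matrix.one_apply]

lemma one_kronecker_mulVec_bipVec (K : Matrix (Fin c) (Fin b) ℂ) (X : Matrix (Fin a) (Fin b) ℂ) :
    ((1 : Matrix (Fin a) (Fin a) ℂ) ⊗ₖ K) *ᵥ bipVec X = bipVec (X * Kᵀ) := by
  ext ⟨i, k⟩
  simp [mulVec, dotProduct, bipVec, Fintype.sum_prod_type, Matrix.mul_apply, Matrix.one_apply,
    mul_comm]

lemma conjBy_vecMulVec {m n : Type*} [Fintype m] (K : Matrix n m ℂ) (v : m → ℂ) :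
    conjBy K (vecMulVec v (star v)) = vecMulVec (K *ᵥ v) (star (K *ᵥ v)) := by
  simp only [conjBy, LinearMap.coe_mk, AddHom.coe_mk]
  rw [mul_vecMulVec, vecMulVec_mul, star_mulVec]

lemma dotProduct_vecMulVec_mulVec {n : Type*} [Fintype n] (ψ v : n → ℂ) :
    star ψ ⬝ᵥ vecMulVec v (star v) *ᵥ ψ = (‖star ψ ⬝ᵥ v‖ ^ 2 : ℝ) := by
  rw [vecMulVec_mulVec, dotProduct_smul, Complex.ofReal_pow, ← Complex.mul_conj']
  rw [star_dotProduct v ψ, op_smul_eq_mul, Complex.star_def]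

lemma re_trace_self_mul_conjTranspose_nonneg (X : Matrix (Fin a) (Fin b) ℂ) :
    0 ≤ (X * Xᴴ).trace.re :=
  (Complex.le_def.mp (posSemidef_self_mul_conjTranspose X).trace_nonneg).1

/-- The Cauchy-Schwarz inequality for the Hilbert-Schmidt inner product. -/
lemma norm_trace_mul_conjTranspose_sq_le (X P : Matrix (Fin a) (Fin b) ℂ) :
    ‖(X * Pᴴ).trace‖ ^ 2 ≤ (X * Xᴴ).trace.re * (P * Pᴴ).trace.re := by
  have key (Z W : Matrix (Fin a) (Fin b) ℂ) :
      (Z * Wᴴ).trace = inner ℂ (WithLp.toLp 2 (bipVec W)) (WithLp.toLp 2 (bipVec Z)) := by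
    rw [EuclideanSpace.inner_eq_star_dotProduct, ← star_bipVec_dotProduct, dotProduct_comm]
  have h (Z : Matrix (Fin a) (Fin b) ℂ) :
      (Z * Zᴴ).trace.re = ‖WithLp.toLp 2 (bipVec Z)‖ ^ 2 := by
    rw [key, inner_self_eq_norm_sq_to_K]
    norm_cast
  rw [h, h, key, ← mul_pow, mul_comm]
  gcongr
  exact norm_inner_le_norm _ _

lemma trace_coeffMatrix_mul_conjTranspose (φ : BipVec a b) :
    (coeffMatrix φ * (coeffMatrix φ)ᴴ).trace = ((‖φ‖ ^ 2 : ℝ) : ℂ) := by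
  rw [← star_bipVec_dotProduct, bipVec_coeffMatrix, dotProduct_comm,
    ← EuclideanSpace.inner_eq_star_dotProduct, inner_self_eq_norm_sq_to_K]
  norm_cast

end Bipartite

/-! ### Pulling a pure target back through an LOCC operation -/

section Converse

variable {a b d : ℕ}

/-- The least squares inequality: `∑ (Yᵢ - Kᵢ Z)ᴴ (Yᵢ - Kᵢ Z) ≥ 0` for `Z = ∑ Kᵢᴴ Yᵢ`. -/
lemma conjTranspose_mul_self_sum_le {ι m n p : Type*} [Fintype ι] [Fintype m] [Fintype n]
    [Fintype p] [DecidableEq m] (K : ι → Matrix p m ℂ) (hK : ∑ i, (K i)ᴴ * K i = 1)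
    (Y : ι → Matrix p n ℂ) :
    (∑ i, (K i)ᴴ * Y i)ᴴ * (∑ i, (K i)ᴴ * Y i) ≤ ∑ i, (Y i)ᴴ * Y i := by
  set Z := ∑ i, (K i)ᴴ * Y i with hZ
  have h1 : ∑ i, (Y i)ᴴ * (K i * Z) = Zᴴ * Z := by
    simp only [← Matrix.mul_assoc, ← Matrix.sum_mul]
    congr 1
    simp [hZ, conjTranspose_sum]
  have h2 : ∑ i, (K i * Z)ᴴ * Y i = Zᴴ * Z := by
    simp only [conjTranspose_mul, Matrix.mul_assoc, ← Matrix.mul_sum]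
    rfl
  have h3 : ∑ i, (K i * Z)ᴴ * (K i * Z) = Zᴴ * Z := by
    have h (i : ι) : (K i * Z)ᴴ * (K i * Z) = Zᴴ * ((K i)ᴴ * K i) * Z := by
      simp only [conjTranspose_mul, Matrix.mul_assoc]
    simp only [h]
    rw [← Matrix.sum_mul, ← Matrix.mul_sum, hK, Matrix.mul_one]
  rw [le_iff]
  have h4 : ∑ i, (Y i)ᴴ * Y i - Zᴴ * Z = ∑ i, (Y i - K i * Z)ᴴ * (Y i - K i * Z) := by
    simp only [conjTranspose_sub, Matrix.sub_mul, Matrix.mul_sub, Finset.sum_sub_distrib, h1, h2,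
      h3]
    abel
  rw [h4]
  exact posSemidef_sum _ fun i _ => posSemidef_conjTranspose_mul_self _

lemma norm_sq_sum_le {ι m n p : Type*} [Fintype ι] [Fintype m] [Fintype n]
    [Fintype p] [DecidableEq m] [DecidableEq n] (K : ι → Matrix p m ℂ)
    (hK : ∑ i, (K i)ᴴ * K i = 1) (Y : ι → Matrix p n ℂ) :
    ‖∑ i, (K i)ᴴ * Y i‖ ^ 2 ≤ ∑ i, ‖Y i‖ ^ 2 := by
  rw [sq, ← l2_opNorm_conjTranspose_mul_self]
  refine (CStarAlgebra.norm_le_norm_of_nonneg_of_le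
    (posSemidef_conjTranspose_mul_self _).nonneg (conjTranspose_mul_self_sum_le K hK Y)).trans ?_
  refine (norm_sum_le _ _).trans (Finset.sum_le_sum fun i _ => ?_)
  rw [sq, l2_opNorm_conjTranspose_mul_self]

lemma re_trace_sum_le {ι m n p : Type*} [Fintype ι] [Fintype m] [Fintype n]
    [Fintype p] [DecidableEq m] (K : ι → Matrix p m ℂ)
    (hK : ∑ i, (K i)ᴴ * K i = 1) (Y : ι → Matrix p n ℂ) :
    ((∑ i, (K i)ᴴ * Y i) * (∑ i, (K i)ᴴ * Y i)ᴴ).trace.re ≤ ∑ i, (Y i * (Y i)ᴴ).trace.re := by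
  have h := (le_iff.mp (conjTranspose_mul_self_sum_le K hK Y)).trace_nonneg
  rw [trace_sub, trace_sum] at h
  have h2 := (Complex.le_def.mp h).1
  rw [Complex.sub_re, Complex.re_sum, Complex.zero_re] at h2
  rw [trace_mul_comm]
  simp only [trace_mul_comm (Y _)]
  linarith

lemma IsLOCC.posSemidef {Λ : BipOp a b →ₗ[ℂ] BipOp d d} (hΛ : IsLOCC Λ) {A : BipOp a b}
    (hA : A.PosSemidef) : (Λ A).PosSemidef := by
  induction hΛ with
  | nil => exact hA
  | alice K hK Λ hΛ ih =>
    simp only [LinearMap.sum_apply, LinearMap.comp_apply]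
    exact posSemidef_sum _ fun i _ => ih i (hA.mul_mul_conjTranspose_same _)
  | bob K hK Λ hΛ ih =>
    simp only [LinearMap.sum_apply, LinearMap.comp_apply]
    exact posSemidef_sum _ fun i _ => ih i (hA.mul_mul_conjTranspose_same _)

/-- Pulling the target `|P⟩` back through an LOCC operation `Λ = ∑ Kᵢ · Kᵢ†`, the witness is
`|Y⟩ = ∑ Kᵢ† |P⟩⟨P| Kᵢ |X⟩`. Its overlap with `|X⟩` is the squared fidelity of `Λ(|X⟩⟨X|)` with
`|P⟩`, and its largest Schmidt coefficient is controlled by that of `|P⟩`. -/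
lemma IsLOCC.exists_witness {Λ : BipOp a b →ₗ[ℂ] BipOp d d} (hΛ : IsLOCC Λ)
    (P : Matrix (Fin d) (Fin d) ℂ) (hP : (P * Pᴴ).trace.re ≤ 1) (X : Matrix (Fin a) (Fin b) ℂ) :
    ∃ Y : Matrix (Fin a) (Fin b) ℂ,
      ‖Y‖ ^ 2 ≤ ‖P‖ ^ 2 * (X * Xᴴ).trace.re ∧ (Y * Yᴴ).trace.re ≤ (X * Xᴴ).trace.re ∧
      (star (bipVec P) ⬝ᵥ Λ (vecMulVec (bipVec X) (star (bipVec X))) *ᵥ bipVec P).re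
        ≤ (X * Yᴴ).trace.re := by
  induction hΛ with
  | nil =>
    set z := (X * Pᴴ).trace with hz
    have hzn : ‖z‖ ^ 2 ≤ (X * Xᴴ).trace.re :=
      (norm_trace_mul_conjTranspose_sq_le X P).trans
        (mul_le_of_le_one_right (re_trace_self_mul_conjTranspose_nonneg X) hP)
    refine ⟨z • P, ?_, ?_, ?_⟩
    · rw [norm_smul, mul_pow, mul_comm]
      gcongr
    · rw [conjTranspose_smul, Matrix.smul_mul, Matrix.mul_smul, smul_smul, trace_smul,
        smul_eq_mul, Complex.star_def, Complex.mul_conj', ← Complex.ofReal_pow,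
        Complex.re_ofReal_mul]
      exact (mul_le_of_le_one_right (by positivity) hP).trans hzn
    · rw [LinearMap.id_apply, dotProduct_vecMulVec_mulVec, star_bipVec_dotProduct, ← hz,
        conjTranspose_smul, Matrix.mul_smul, trace_smul, ← hz, smul_eq_mul, mul_comm,
        Complex.star_def, Complex.mul_conj']
      norm_cast
  | alice K hK Λ hΛ ih =>
    choose Y hY1 hY2 hY3 using fun i => ih i (K i * X)
    have htr : ∑ i, ((K i * X) * (K i * X)ᴴ).trace.re = (X * Xᴴ).trace.re := by
      have h (i) : ((K i * X) * (K i * X)ᴴ).trace = (((K i)ᴴ * K i) * (X * Xᴴ)).trace := by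
        rw [conjTranspose_mul, trace_mul_comm]
        simp only [Matrix.mul_assoc]
        rw [trace_mul_comm]
        simp only [Matrix.mul_assoc]
      simp only [h]
      rw [← Complex.re_sum, ← trace_sum, ← Matrix.sum_mul, hK, Matrix.one_mul]
    refine ⟨∑ i, (K i)ᴴ * Y i, ?_, ?_, ?_⟩
    · rw [← htr, Finset.mul_sum]
      exact (norm_sq_sum_le K hK Y).trans (Finset.sum_le_sum fun i _ => hY1 i)
    · rw [← htr]
      exact (re_trace_sum_le K hK Y).trans (Finset.sum_le_sum fun i _ => hY2 i)
    · rw [LinearMap.sum_apply, Matrix.sum_mulVec, dotProduct_sum, Complex.re_sum,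
        conjTranspose_sum, Matrix.mul_sum, trace_sum, Complex.re_sum]
      refine Finset.sum_le_sum fun i _ => ?_
      rw [LinearMap.comp_apply, conjBy_vecMulVec, kronecker_one_mulVec_bipVec]
      refine (hY3 i).trans (le_of_eq ?_)
      rw [conjTranspose_mul, conjTranspose_conjTranspose, ← Matrix.mul_assoc, Matrix.mul_assoc,
        trace_mul_comm]
  | bob K hK Λ hΛ ih =>
    -- Bob's operators multiply coefficient matrices from the right, so the two inequalities for
    -- sums are applied to the adjoints, with the complex conjugates of his Kraus operators.
    choose Y hY1 hY2 hY3 using fun i => ih i (X * (K i)ᵀ)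
    have hT (i) : ((K i).map star)ᴴ = (K i)ᵀ := by
      ext j k
      simp
    have hT' (i) : (K i)ᴴᵀ = (K i).map star := by
      ext j k
      simp
    have hK' : ∑ i, ((K i).map star)ᴴ * (K i).map star = 1 := by
      have h (i) : ((K i).map star)ᴴ * (K i).map star = ((K i)ᴴ * K i)ᵀ := by
        rw [transpose_mul, hT, hT']
      simp only [h]
      rw [← transpose_sum, hK, transpose_one]
    have htr : ∑ i, ((X * (K i)ᵀ) * (X * (K i)ᵀ)ᴴ).trace.re = (X * Xᴴ).trace.re := by
      have h (i) : ((X * (K i)ᵀ) * (X * (K i)ᵀ)ᴴ).trace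
          = (X * (((K i).map star)ᴴ * (K i).map star) * Xᴴ).trace := by
        rw [← hT, conjTranspose_mul, conjTranspose_conjTranspose]
        simp only [Matrix.mul_assoc]
      simp only [h]
      rw [← Complex.re_sum, ← trace_sum, ← Matrix.sum_mul, ← Matrix.mul_sum, hK', Matrix.mul_one]
    have hadj : ∑ i, ((K i).map star)ᴴ * (Y i)ᴴ = (∑ i, Y i * (K i).map star)ᴴ := by
      simp only [conjTranspose_sum, conjTranspose_mul]
    refine ⟨∑ i, Y i * (K i).map star, ?_, ?_, ?_⟩
    · rw [← htr, Finset.mul_sum, ← l2_opNorm_conjTranspose, ← hadj]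
      refine (norm_sq_sum_le _ hK' _).trans (Finset.sum_le_sum fun i _ => ?_)
      rw [l2_opNorm_conjTranspose]
      exact hY1 i
    · have h := re_trace_sum_le _ hK' fun i => (Y i)ᴴ
      rw [hadj, trace_mul_comm, conjTranspose_conjTranspose] at h
      rw [← htr]
      refine h.trans (Finset.sum_le_sum fun i _ => ?_)
      rw [trace_mul_comm, conjTranspose_conjTranspose]
      exact hY2 i
    · rw [LinearMap.sum_apply, Matrix.sum_mulVec, dotProduct_sum, Complex.re_sum,
        ← hadj, Matrix.mul_sum, trace_sum, Complex.re_sum]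
      refine Finset.sum_le_sum fun i _ => ?_
      rw [LinearMap.comp_apply, conjBy_vecMulVec, one_kronecker_mulVec_bipVec]
      refine (hY3 i).trans (le_of_eq ?_)
      rw [← Matrix.mul_assoc, hT]

end Converse

/-! ### Maximally entangled states -/

section MaxEntangled

variable {a b d : ℕ}

lemma norm_le_one_of_conjTranspose_mul_self_eq_one {m n : Type*} [Fintype m] [Fintype n]
    [DecidableEq n] {A : Matrix m n ℂ} (h : Aᴴ * A = 1) : ‖A‖ ≤ 1 :=
  (norm_le_one_iff_conjTranspose_mul_self_le A).mpr h.le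

/-- The matrix whose columns are the vectors of an orthonormal basis. -/
noncomputable def basisMatrix (e : OrthonormalBasis (Fin d) ℂ (EuclideanSpace ℂ (Fin d))) :
    Matrix (Fin d) (Fin d) ℂ := Matrix.of fun x i => e i x

lemma conjTranspose_mul_basisMatrix
    (e : OrthonormalBasis (Fin d) ℂ (EuclideanSpace ℂ (Fin d))) :
    (basisMatrix e)ᴴ * basisMatrix e = 1 := by
  ext i j
  have h := orthonormal_iff_ite.mp e.orthonormal i j
  rw [EuclideanSpace.inner_eq_star_dotProduct, dotProduct_comm] at h
  simpa [Matrix.mul_apply, basisMatrix, dotProduct, Matrix.one_apply] using h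

/-- The projection onto the first `M` vectors of the standard basis. -/
def initialProj (d M : ℕ) : Matrix (Fin d) (Fin d) ℂ :=
  diagonal fun i => if (i : ℕ) < M then 1 else 0

lemma initialProj_conjTranspose (d M : ℕ) : (initialProj d M)ᴴ = initialProj d M := by
  rw [initialProj, diagonal_conjTranspose]
  congr 1
  ext i
  simp only [Pi.star_apply]
  split_ifs <;> simp

lemma initialProj_mul_self (d M : ℕ) : initialProj d M * initialProj d M = initialProj d M := by
  simp [initialProj, diagonal_mul_diagonal]

lemma norm_initialProj_le (d M : ℕ) : ‖initialProj d M‖ ≤ 1 := by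
  rw [initialProj, l2_opNorm_diagonal, pi_norm_le_iff_of_nonneg zero_le_one]
  intro i
  split_ifs <;> simp

lemma re_trace_initialProj_le (d M : ℕ) : (initialProj d M).trace.re ≤ M := by
  rw [initialProj, trace_diagonal, Finset.sum_ite, Finset.sum_const_zero, add_zero,
    Finset.sum_const, nsmul_one, Complex.natCast_re]
  have h : (Finset.univ.filter fun i : Fin d => (i : ℕ) < M).card ≤ (Finset.range M).card :=
    Finset.card_le_card_of_injOn Fin.val (fun i hi => by simpa using hi)
      Fin.val_injective.injOn
  rw [Finset.card_range] at h
  exact_mod_cast h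

lemma IsMaxEntangled.coeffMatrix_eq {M : ℕ} {Ψ : BipVec d d} (h : IsMaxEntangled M Ψ) :
    ∃ e f : OrthonormalBasis (Fin d) ℂ (EuclideanSpace ℂ (Fin d)),
      coeffMatrix Ψ = ((√M)⁻¹ : ℝ) •
        (basisMatrix e * initialProj d M * (basisMatrix f)ᵀ) := by
  obtain ⟨-, e, f, hef⟩ := h
  refine ⟨e, f, ?_⟩
  ext x y
  rw [coeffMatrix, of_apply, hef, Matrix.smul_apply, Complex.real_smul, Complex.ofReal_inv]
  congr 1
  rw [initialProj, Matrix.mul_apply]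
  refine Finset.sum_congr rfl fun i _ => ?_
  rw [mul_diagonal, transpose_apply]
  split_ifs <;> simp [basisMatrix]

lemma IsMaxEntangled.norm_coeffMatrix_sq_le {M : ℕ} {Ψ : BipVec d d} (h : IsMaxEntangled M Ψ) :
    ‖coeffMatrix Ψ‖ ^ 2 ≤ (M : ℝ)⁻¹ := by
  obtain ⟨e, f, hef⟩ := h.coeffMatrix_eq
  have h1 := norm_le_one_of_conjTranspose_mul_self_eq_one (conjTranspose_mul_basisMatrix e)
  have h2 : ‖(basisMatrix f)ᵀ‖ ≤ 1 := by
    rw [← l2_opNorm_conjTranspose]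
    refine norm_le_one_of_conjTranspose_mul_self_eq_one ?_
    have h := congrArg transpose (conjTranspose_mul_basisMatrix f)
    rw [transpose_mul, transpose_one] at h
    rw [conjTranspose_conjTranspose]
    exact h
  have h3 : ‖basisMatrix e * initialProj d M * (basisMatrix f)ᵀ‖ ≤ 1 :=
    (l2_opNorm_mul _ _).trans (mul_le_one₀ ((l2_opNorm_mul _ _).trans
      (mul_le_one₀ h1 (norm_nonneg _) (norm_initialProj_le d M))) (norm_nonneg _) h2)
  rw [hef, norm_smul, mul_pow, Real.norm_eq_abs, sq_abs, inv_pow, Real.sq_sqrt (by positivity)]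
  exact mul_le_of_le_one_right (by positivity) (pow_le_one₀ (norm_nonneg _) h3)

lemma IsMaxEntangled.re_trace_le_one {M : ℕ} {Ψ : BipVec d d} (h : IsMaxEntangled M Ψ) :
    (coeffMatrix Ψ * (coeffMatrix Ψ)ᴴ).trace.re ≤ 1 := by
  obtain ⟨e, f, hef⟩ := h.coeffMatrix_eq
  have hf : (basisMatrix f)ᵀ * (basisMatrix f)ᵀᴴ = 1 := by
    have h := congrArg transpose (conjTranspose_mul_basisMatrix f)
    rw [transpose_mul, transpose_one] at h
    exact h
  have h1 : (basisMatrix e * initialProj d M * (basisMatrix f)ᵀ *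
      (basisMatrix e * initialProj d M * (basisMatrix f)ᵀ)ᴴ).trace = (initialProj d M).trace := by
    rw [conjTranspose_mul, conjTranspose_mul, initialProj_conjTranspose, Matrix.mul_assoc,
      ← Matrix.mul_assoc (basisMatrix f)ᵀ, hf, Matrix.one_mul, Matrix.mul_assoc, trace_mul_comm,
      ← Matrix.mul_assoc, initialProj_mul_self, Matrix.mul_assoc, conjTranspose_mul_basisMatrix,
      Matrix.mul_one]
  rw [hef, conjTranspose_smul, Matrix.smul_mul, Matrix.mul_smul, smul_smul, trace_smul, h1,
    star_trivial, ← mul_inv, Real.mul_self_sqrt (by positivity), Complex.smul_re, smul_eq_mul]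
  exact (mul_le_mul_of_nonneg_left (re_trace_initialProj_le d M) (by positivity)).trans
    inv_mul_le_one

end MaxEntangled

/-! ### Upper bounds on the rank of a reachable target -/

section UpperBound

variable {a b d : ℕ}

lemma trace_coeffMatrix_mul_conjTranspose_of_norm_eq_one {φ : BipVec a b} (hφ : ‖φ‖ = 1) :
    (coeffMatrix φ * (coeffMatrix φ)ᴴ).trace = 1 := by
  rw [trace_coeffMatrix_mul_conjTranspose, hφ, one_pow, Complex.ofReal_one]

lemma traceB_proj_posSemidef (φ : BipVec a b) : (traceB (proj φ)).PosSemidef := by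
  rw [traceB_proj]
  exact posSemidef_self_mul_conjTranspose _

lemma trace_traceB_proj {φ : BipVec a b} (hφ : ‖φ‖ = 1) : (traceB (proj φ)).trace = 1 := by
  rw [traceB_proj, trace_coeffMatrix_mul_conjTranspose_of_norm_eq_one hφ]

lemma exists_witness_of_fidelity {φ : BipVec a b} (hφ : ‖φ‖ = 1) {ε : ℝ} {M : ℕ}
    {Ψ : BipVec d d} (hΨ : IsMaxEntangled M Ψ) {Λ : BipOp a b →ₗ[ℂ] BipOp d d} (hΛ : IsLOCC Λ)
    (h : 1 - ε ≤ fidelity (Λ (proj φ)) (proj Ψ) ^ 2) :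
    ∃ Y : Matrix (Fin a) (Fin b) ℂ, ‖Y‖ ^ 2 ≤ (M : ℝ)⁻¹ ∧ (Y * Yᴴ).trace.re ≤ 1 ∧
      1 - ε ≤ (coeffMatrix φ * Yᴴ).trace.re := by
  obtain ⟨Y, hY1, hY2, hY3⟩ := hΛ.exists_witness _ hΨ.re_trace_le_one (coeffMatrix φ)
  rw [trace_coeffMatrix_mul_conjTranspose_of_norm_eq_one hφ, Complex.one_re] at hY1 hY2
  rw [mul_one] at hY1
  refine ⟨Y, hY1.trans hΨ.norm_coeffMatrix_sq_le, hY2, ?_⟩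
  have hpos : (Λ (proj φ)).PosSemidef := hΛ.posSemidef (posSemidef_vecMulVec_self_star _)
  rw [fidelity_proj_sq hpos] at h
  exact h.trans hY3

lemma sq_le_re_trace_of_le {φ : BipVec a b} (hφ : ‖φ‖ = 1) {c : ℝ} (hc : 0 ≤ c)
    {Y : Matrix (Fin a) (Fin b) ℂ} (h : c ≤ (coeffMatrix φ * Yᴴ).trace.re) :
    c ^ 2 ≤ (Y * Yᴴ).trace.re := by
  have h1 := norm_trace_mul_conjTranspose_sq_le (coeffMatrix φ) Y
  rw [trace_coeffMatrix_mul_conjTranspose_of_norm_eq_one hφ, Complex.one_re, one_mul] at h1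
  refine le_trans ?_ h1
  gcongr
  exact h.trans (Complex.re_le_norm _)

/-- A target of rank `M` cannot be reached from `ℂ^a ⊗ ℂ^b` with fidelity bounded below as
`M → ∞`. -/
lemma rank_le_of_fidelity {φ : BipVec a b} (hφ : ‖φ‖ = 1) {ε : ℝ} (hε : ε < 1) {M : ℕ}
    (hM : 0 < M) {Ψ : BipVec d d} (hΨ : IsMaxEntangled M Ψ) {Λ : BipOp a b →ₗ[ℂ] BipOp d d}
    (hΛ : IsLOCC Λ) (h : 1 - ε ≤ fidelity (Λ (proj φ)) (proj Ψ) ^ 2) :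
    (M : ℝ) ≤ a / (1 - ε) ^ 2 := by
  obtain ⟨Y, hY1, -, hY3⟩ := exists_witness_of_fidelity hφ hΨ hΛ h
  have hε' : 0 < 1 - ε := by linarith
  have h1 := sq_le_re_trace_of_le hφ hε'.le hY3
  have h2 := re_trace_le_card_mul_norm (posSemidef_self_mul_conjTranspose Y)
  have h3 : ‖Y * Yᴴ‖ ≤ (M : ℝ)⁻¹ := by
    refine (l2_opNorm_mul _ _).trans ?_
    rwa [l2_opNorm_conjTranspose, ← sq]
  rw [Fintype.card_fin] at h2
  have h4 : (1 - ε) ^ 2 ≤ a * (M : ℝ)⁻¹ :=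
    h1.trans (h2.trans (mul_le_mul_of_nonneg_left h3 (by positivity)))
  have hM' : (0 : ℝ) < M := by exact_mod_cast hM
  rw [le_div_iff₀ (by positivity)]
  rw [← div_eq_mul_inv, le_div_iff₀ hM'] at h4
  linarith

lemma logb_rank_le_smoothMinEntropy {φ : BipVec a b} (hφ : ‖φ‖ = 1) {ε : ℝ} (hε0 : 0 ≤ ε)
    (hε : ε < 1 / 4) {M : ℕ} (hM : 0 < M) {Ψ : BipVec d d} (hΨ : IsMaxEntangled M Ψ)
    {Λ : BipOp a b →ₗ[ℂ] BipOp d d} (hΛ : IsLOCC Λ)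
    (h : 1 - ε ≤ fidelity (Λ (proj φ)) (proj Ψ) ^ 2) :
    Real.logb 2 M ≤
      smoothMinEntropy √(2 * √ε) (traceB (proj φ)) - Real.logb 2 (1 - 2 * √ε) := by
  obtain ⟨Y, hY1, hY2, hY3⟩ := exists_witness_of_fidelity hφ hΨ hΛ h
  have hs0 : 0 ≤ √ε := Real.sqrt_nonneg ε
  have hs1 : √ε < 1 / 2 := by
    rw [Real.sqrt_lt' (by norm_num)]
    linarith
  have hs2 : √ε ^ 2 = ε := Real.sq_sqrt hε0
  have hM' : (0 : ℝ) < M := by exact_mod_cast hM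
  set t := (Y * Yᴴ).trace.re with ht
  have ht1 : (1 - ε) ^ 2 ≤ t := sq_le_re_trace_of_le hφ (by linarith) hY3
  have hεs : 1 - 2 * √ε ≤ (1 - ε) ^ 2 := by nlinarith
  have ht0 : 0 < t := by nlinarith
  have hpos := posSemidef_self_mul_conjTranspose Y
  have htr : (Y * Yᴴ).trace = (t : ℂ) :=
    Complex.ext rfl (Complex.le_def.mp hpos.trace_nonneg).2.symm
  -- Normalizing the witness `Y` costs the factor `1 / t` in the largest eigenvalue and can only
  -- increase the overlap with `φ`.
  set Z : Matrix (Fin a) (Fin b) ℂ := ((√t)⁻¹ : ℝ) • Y with hZ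
  have hZZ : Z * Zᴴ = (t⁻¹ : ℝ) • (Y * Yᴴ) := by
    rw [hZ, conjTranspose_smul, Matrix.smul_mul, Matrix.mul_smul, smul_smul, star_trivial,
      ← mul_inv, Real.mul_self_sqrt ht0.le]
  have hZtr : (Z * Zᴴ).trace = 1 := by
    rw [hZZ, trace_smul, htr, Complex.real_smul, ← Complex.ofReal_mul, inv_mul_cancel₀ ht0.ne',
      Complex.ofReal_one]
  have hZnorm : ‖Z * Zᴴ‖ ≤ t⁻¹ * (M : ℝ)⁻¹ := by
    rw [hZZ, norm_smul, Real.norm_of_nonneg (by positivity)]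
    gcongr
    refine (l2_opNorm_mul _ _).trans ?_
    rwa [l2_opNorm_conjTranspose, ← sq]
  have hov : 1 - ε ≤ (coeffMatrix φ * Zᴴ).trace.re := by
    rw [hZ, conjTranspose_smul, Matrix.mul_smul, trace_smul, star_trivial, Complex.smul_re,
      smul_eq_mul]
    have h1 : √t ≤ 1 := Real.sqrt_le_one.mpr hY2
    have h2 : 1 ≤ (√t)⁻¹ := (one_le_inv₀ (Real.sqrt_pos.mpr ht0)).mpr h1
    nlinarith
  have hF := hov.trans (re_trace_mul_conjTranspose_le_fidelity (coeffMatrix φ) Z)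
  have hmem : Z * Zᴴ ∈ stateBall (traceB (proj φ)) √(2 * √ε) := by
    refine ⟨posSemidef_self_mul_conjTranspose Z, hZtr, ?_⟩
    rw [traceB_proj, Real.sq_sqrt (by positivity)]
    refine hεs.trans ?_
    gcongr
    linarith
  have hmax := (isGreatest_smoothMinEntropy (traceB_proj_posSemidef φ) (trace_traceB_proj hφ)
    √(2 * √ε)).2 ⟨_, hmem, rfl⟩
  rw [minEntropy_eq (posSemidef_self_mul_conjTranspose Z)] at hmax
  have hlog : Real.logb 2 ‖Z * Zᴴ‖ ≤ Real.logb 2 ((1 - 2 * √ε)⁻¹ * (M : ℝ)⁻¹) := by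
    refine Real.logb_le_logb_of_le one_lt_two (norm_pos_of_trace_eq_one hZtr) (hZnorm.trans ?_)
    gcongr
    · linarith
    · linarith
  rw [← mul_inv, Real.logb_inv, Real.logb_mul (by linarith) hM'.ne'] at hlog
  linarith

end UpperBound

/-! ### Mixtures of projections of fixed rank -/

section Birkhoff

/-- A state whose eigenvalues are at most `1 / N` is a mixture of normalized projections of
rank `N`. The spectrum `p` of the state as each of the first `N` rows, and the complement `1 - N p`
spread evenly over the remaining ones, form a doubly stochastic matrix. Each permutation in its
Birkhoff decomposition selects `N` eigenvectors, which are the columns of `J π`. -/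
lemma exists_mixture_of_isometries {a N : ℕ} {σ : Matrix (Fin a) (Fin a) ℂ} (hσ : σ.PosSemidef)
    (h1 : σ.trace = 1) (hN : 0 < N) (hle : ‖σ‖ ≤ (N : ℝ)⁻¹) :
    ∃ (q : Equiv.Perm (Fin a) → ℝ) (J : Equiv.Perm (Fin a) → Matrix (Fin a) (Fin N) ℂ),
      (∀ π, 0 ≤ q π) ∧ ∑ π, q π = 1 ∧ (∀ π, (J π)ᴴ * J π = 1) ∧
      ∑ π, (q π : ℂ) • (J π * (J π)ᴴ) = (N : ℂ) • σ := by
  have hN' : (0 : ℝ) < N := by exact_mod_cast hN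
  have hNa : N ≤ a := by
    have h := re_trace_le_card_mul_norm hσ
    rw [h1, Complex.one_re, Fintype.card_fin] at h
    have h2 : (1 : ℝ) ≤ a * (N : ℝ)⁻¹ := h.trans (by gcongr)
    rw [← div_eq_mul_inv, one_le_div hN'] at h2
    exact_mod_cast h2
  obtain ⟨k, rfl⟩ := Nat.exists_eq_add_of_le hNa
  set p := hσ.isHermitian.eigenvalues with hp
  set U : Matrix (Fin (N + k)) (Fin (N + k)) ℂ :=
    (hσ.isHermitian.eigenvectorUnitary : Matrix (Fin (N + k)) (Fin (N + k)) ℂ) with hU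
  have hUU : Uᴴ * U = 1 := by
    rw [← star_eq_conjTranspose]
    exact Unitary.coe_star_mul_self hσ.isHermitian.eigenvectorUnitary
  have hp0 (j) : 0 ≤ p j := hσ.eigenvalues_nonneg j
  have hpN (j) : 0 ≤ 1 - N * p j := by
    have : Nonempty (Fin (N + k)) := ⟨j⟩
    have h := (Real.le_norm_self _).trans
      (spectrum.norm_le_norm_of_mem (hσ.isHermitian.eigenvalues_mem_spectrum_real j))
    have h2 := mul_le_mul_of_nonneg_left (h.trans hle) hN'.le
    rw [mul_inv_cancel₀ hN'.ne'] at h2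
    linarith
  have hsum : ∑ j, p j = 1 := by
    have h := hσ.isHermitian.trace_eq_sum_eigenvalues
    have h3 : ((∑ j, p j : ℝ) : ℂ) = 1 := by
      rw [Complex.ofReal_sum, ← h1, h]
      rfl
    exact_mod_cast h3
  have hcomp : ∑ j, (1 - N * p j) = k := by
    rw [Finset.sum_sub_distrib, ← Finset.mul_sum, hsum]
    simp
  set D : Matrix (Fin (N + k)) (Fin (N + k)) ℝ :=
    Matrix.of fun i j => Fin.addCases (fun _ => p j) (fun _ => (1 - N * p j) / k) i with hD
  have hDl (i : Fin N) (j) : D (Fin.castAdd k i) j = p j := by simp [hD]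
  have hDr (i : Fin k) (j) : D (Fin.natAdd N i) j = (1 - N * p j) / k := by simp [hD]
  have hDmem : D ∈ doublyStochastic ℝ (Fin (N + k)) := by
    rw [mem_doublyStochastic_iff_sum]
    refine ⟨fun i j => ?_, fun i => ?_, fun j => ?_⟩
    · refine Fin.addCases (fun i => ?_) (fun i => ?_) i
      · rw [hDl]
        exact hp0 j
      · rw [hDr]
        exact div_nonneg (hpN j) (by positivity)
    · refine Fin.addCases (fun i => ?_) (fun i => ?_) i
      · simp only [hDl, hsum]
      · have hk : (k : ℝ) ≠ 0 := by
          have := i.pos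
          positivity
        simp only [hDr]
        rw [← Finset.sum_div, hcomp, div_self hk]
    · rw [Fin.sum_univ_add]
      simp only [hDl, hDr, Finset.sum_const, Finset.card_univ, Fintype.card_fin, nsmul_eq_mul]
      -- For `k = 0` the complement `1 - N p` vanishes, so that the division by `k` is harmless.
      rw [mul_div_cancel_of_imp']
      · ring
      · intro hk
        rw [hk] at hcomp
        exact (Finset.sum_eq_zero_iff_of_nonneg fun j _ => hpN j).mp hcomp j (Finset.mem_univ j)
  obtain ⟨q, hq0, hq1, hqD⟩ := exists_eq_sum_perm_of_mem_doublyStochastic hDmem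
  have havg (i : Fin N) (g : Fin (N + k) → ℂ) :
      ∑ π : Equiv.Perm (Fin (N + k)), (q π : ℂ) * g (π (Fin.castAdd k i))
        = ∑ j, (p j : ℂ) * g j := by
    have h (j) : (p j : ℂ) = ∑ π : Equiv.Perm (Fin (N + k)),
        (q π : ℂ) * if π (Fin.castAdd k i) = j then 1 else 0 := by
      rw [← hDl i j, ← hqD, Matrix.sum_apply, Complex.ofReal_sum]
      refine Finset.sum_congr rfl fun π _ => ?_
      simp only [Matrix.smul_apply, PEquiv.toMatrix_apply, Equiv.toPEquiv_apply, Option.mem_def,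
        Option.some.injEq, smul_eq_mul]
      split_ifs <;> simp
    simp only [h, Finset.sum_mul]
    rw [Finset.sum_comm]
    refine Finset.sum_congr rfl fun π _ => ?_
    simp
  have hspec (x y) : σ x y = ∑ j, (p j : ℂ) * (U x j * star (U y j)) := by
    have h := congrFun₂ hσ.isHermitian.spectral_theorem x y
    rw [Unitary.conjStarAlgAut_apply, Matrix.mul_apply] at h
    rw [h]
    refine Finset.sum_congr rfl fun j _ => ?_
    rw [mul_diagonal, star_apply]
    simp only [Function.comp_apply]
    change U x j * (p j : ℂ) * star (U y j) = _
    ring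
  refine ⟨q, fun π => U.submatrix id fun i => π (Fin.castAdd k i), hq0, hq1, fun π => ?_, ?_⟩
  · rw [conjTranspose_submatrix, ← submatrix_mul _ _ _ _ _ Function.bijective_id, hUU]
    exact submatrix_one _ (π.injective.comp (Fin.castAdd_injective N k))
  · ext x y
    rw [Matrix.sum_apply]
    simp only [Matrix.smul_apply, Matrix.mul_apply, submatrix_apply, id_eq, conjTranspose_apply,
      smul_eq_mul, Finset.mul_sum]
    rw [Finset.sum_comm]
    simp only [havg _ fun j => U x j * star (U y j), ← hspec]
    simp

end Birkhoff

/-! ### One-way protocols -/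

section Protocol

variable {a b m : ℕ}

/-- A family with `∑ Kᵢ† Kᵢ ≤ 1` is part of a measurement: with `C† C = 1 - ∑ Kᵢ† Kᵢ`, the
operators `|0⟩⟨j| C` are the missing ones. -/
lemma exists_measurement_extending {ι : Type*} [Fintype ι] (hm : 0 < m)
    (K : ι → Matrix (Fin m) (Fin a) ℂ) (hK : ∑ i, (K i)ᴴ * K i ≤ 1) :
    ∃ (r : ℕ) (L : Fin r → Matrix (Fin m) (Fin a) ℂ) (f : ι ↪ Fin r),
      ∑ k, (L k)ᴴ * L k = 1 ∧ ∀ i, L (f i) = K i := by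
  obtain ⟨C, hC⟩ := CStarAlgebra.nonneg_iff_eq_star_mul_self.mp (sub_nonneg.mpr hK)
  let E : Fin a → Matrix (Fin m) (Fin a) ℂ := fun j =>
    Matrix.single (⟨0, hm⟩ : Fin m) j (1 : ℂ) * C
  let L' : ι ⊕ Fin a → Matrix (Fin m) (Fin a) ℂ := Sum.elim K E
  let e := Fintype.equivFin (ι ⊕ Fin a)
  refine ⟨_, L' ∘ e.symm, Function.Embedding.inl.trans e.toEmbedding, ?_, fun i => ?_⟩
  · have h : ∑ j, (E j)ᴴ * E j = star C * C := by
      have h2 (j) : (E j)ᴴ * E j = star C * Matrix.single j j 1 * C := by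
        rw [conjTranspose_mul, conjTranspose_single, star_one, Matrix.mul_assoc,
          ← Matrix.mul_assoc (Matrix.single j _ _), single_mul_single_same, mul_one,
          ← Matrix.mul_assoc, star_eq_conjTranspose]
      simp only [h2]
      rw [← Matrix.sum_mul, ← Matrix.mul_sum, sum_single_one, Matrix.mul_one]
    simp only [Function.comp_apply]
    rw [e.symm.sum_comp fun k => (L' k)ᴴ * L' k, Fintype.sum_sum_type]
    simp only [L', Sum.elim_inl, Sum.elim_inr]
    rw [h, ← hC, add_sub_cancel]
  · simp [L', e]

/-- One-way protocols: Alice measures with `A i`, and Bob applies the contraction `B i`. The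
outcomes that complete the two measurements only increase the overlap with the target. -/
lemma exists_isLOCC {ι : Type*} [Fintype ι] (hm : 0 < m)
    (A : ι → Matrix (Fin m) (Fin a) ℂ) (hA : ∑ i, (A i)ᴴ * A i ≤ 1)
    (B : ι → Matrix (Fin m) (Fin b) ℂ) (hB : ∀ i, ‖B i‖ ≤ 1) :
    ∃ Λ : BipOp a b →ₗ[ℂ] BipOp m m, IsLOCC Λ ∧ ∀ X P,
      ∑ i, ‖(A i * X * (B i)ᵀ * Pᴴ).trace‖ ^ 2 ≤
        (star (bipVec P) ⬝ᵥ Λ (vecMulVec (bipVec X) (star (bipVec X))) *ᵥ bipVec P).re := by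
  obtain ⟨r, L, f, hL, hLf⟩ := exists_measurement_extending hm A hA
  have hB' (k) : ‖Function.extend f B 0 k‖ ≤ 1 := by
    by_cases h : ∃ i, f i = k
    · obtain ⟨i, rfl⟩ := h
      rw [f.injective.extend_apply]
      exact hB i
    · rw [Function.extend_apply' _ _ _ h]
      simp
  choose s R g hR hRg using fun k => exists_measurement_extending (ι := Unit) hm
    (fun _ => Function.extend f B 0 k)
    (by simpa using (norm_le_one_iff_conjTranspose_mul_self_le _).mp (hB' k))
  refine ⟨_, .alice L hL _ fun k => .bob (R k) (hR k) _ fun _ => .nil, fun X P => ?_⟩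
  have hterm (k) (l) : (star (bipVec P) ⬝ᵥ
      conjBy ((1 : Matrix (Fin m) (Fin m) ℂ) ⊗ₖ R k l)
        (conjBy (L k ⊗ₖ (1 : Matrix (Fin b) (Fin b) ℂ))
          (vecMulVec (bipVec X) (star (bipVec X)))) *ᵥ bipVec P).re
        = ‖(L k * X * (R k l)ᵀ * Pᴴ).trace‖ ^ 2 := by
    rw [conjBy_vecMulVec, kronecker_one_mulVec_bipVec, conjBy_vecMulVec,
      one_kronecker_mulVec_bipVec, dotProduct_vecMulVec_mulVec, star_bipVec_dotProduct,
      Complex.ofReal_re]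
  simp only [LinearMap.sum_apply, LinearMap.comp_apply, LinearMap.id_apply, Matrix.sum_mulVec,
    dotProduct_sum, Complex.re_sum, hterm]
  calc ∑ i, ‖(A i * X * (B i)ᵀ * Pᴴ).trace‖ ^ 2
      ≤ ∑ i, ∑ l, ‖(L (f i) * X * (R (f i) l)ᵀ * Pᴴ).trace‖ ^ 2 := by
        refine Finset.sum_le_sum fun i _ => ?_
        have h := Finset.single_le_sum
          (f := fun l => ‖(L (f i) * X * (R (f i) l)ᵀ * Pᴴ).trace‖ ^ 2)
          (fun l _ => by positivity) (Finset.mem_univ (g (f i) ()))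
        rw [hRg, f.injective.extend_apply] at h
        rw [← hLf i]
        exact h
    _ = ∑ k ∈ Finset.univ.map f, ∑ l, ‖(L k * X * (R k l)ᵀ * Pᴴ).trace‖ ^ 2 := by
        rw [Finset.sum_map]
    _ ≤ ∑ k, ∑ l, ‖(L k * X * (R k l)ᵀ * Pᴴ).trace‖ ^ 2 :=
        Finset.sum_le_sum_of_subset_of_nonneg (Finset.subset_univ _) fun k _ _ => by positivity

lemma norm_transpose_le_one {m n : Type*} [Fintype m] [Fintype n] [DecidableEq m] [DecidableEq n]
    {A : Matrix m n ℂ} (hA : ‖A‖ ≤ 1) : ‖Aᵀ‖ ≤ 1 := by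
  rw [← l2_opNorm_conjTranspose, norm_le_one_iff_conjTranspose_mul_self_le,
    conjTranspose_conjTranspose] at hA
  rw [norm_le_one_iff_conjTranspose_mul_self_le]
  have h := (le_iff.mp hA).transpose
  rw [transpose_sub, transpose_one, transpose_mul] at h
  exact le_iff.mpr h

/-- The maximally entangled state of rank `N` in `ℂ^N ⊗ ℂ^N`. -/
noncomputable def stdMaxEntangled (N : ℕ) : BipVec N N :=
  WithLp.toLp 2 (bipVec (((√N)⁻¹ : ℝ) • (1 : Matrix (Fin N) (Fin N) ℂ)))

lemma isMaxEntangled_stdMaxEntangled (N : ℕ) : IsMaxEntangled N (stdMaxEntangled N) := by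
  refine ⟨le_rfl, EuclideanSpace.basisFun _ ℂ, EuclideanSpace.basisFun _ ℂ, fun x y => ?_⟩
  simp [stdMaxEntangled, bipVec, Matrix.one_apply]

/-- If `σ` is close to the reduced state of `φ` and its eigenvalues are at most `1 / N`, then a
one-way protocol distils a maximally entangled state of rank `N` from `φ`. For
`N σ = ∑ q_π J_π J_π†`, Alice measures with `√(q_π / N) J_π† σ^(-1/2)`, which would turn a
purification of `σ` into a maximally entangled state for every outcome, and Bob applies `(W J_π)ᵀ`,
where `W` relates `φ` to such a purification by Uhlmann's theorem. -/
lemma isAchievableRate_logb {φ : BipVec a b} {ε : ℝ} {σ : Matrix (Fin a) (Fin a) ℂ}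
    (hσ : σ.PosSemidef) (h1 : σ.trace = 1) {N : ℕ} (hN : 0 < N) (hle : ‖σ‖ ≤ (N : ℝ)⁻¹)
    (hF : 1 - ε ≤ fidelity (traceB (proj φ)) σ ^ 2) :
    IsAchievableRate φ ε (Real.logb 2 N) := by
  have hN' : (0 : ℝ) < N := by exact_mod_cast hN
  have hN1 : (1 : ℝ) ≤ N := by exact_mod_cast hN
  obtain ⟨q, J, hq0, hq1, hJ, hqJ⟩ := exists_mixture_of_isometries hσ h1 hN hle
  obtain ⟨W, hW, hWF⟩ := exists_trace_eq_fidelity (coeffMatrix φ) hσ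
  set G := invSqrt σ with hG
  have hGh : Gᴴ = G := (invSqrt_posSemidef σ).isHermitian
  set A : Equiv.Perm (Fin a) → Matrix (Fin N) (Fin a) ℂ :=
    fun π => (√(q π / N) : ℂ) • ((J π)ᴴ * G) with hAdef
  have hA : ∑ π, (A π)ᴴ * A π ≤ 1 := by
    have h (π) : (A π)ᴴ * A π = (N : ℂ)⁻¹ • (G * ((q π : ℂ) • (J π * (J π)ᴴ)) * G) := by
      have h2 : (√(q π / N) : ℂ) * (√(q π / N) : ℂ) = (N : ℂ)⁻¹ * q π := by
        rw [← Complex.ofReal_mul, Real.mul_self_sqrt (div_nonneg (hq0 π) hN'.le)]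
        push_cast
        ring
      rw [hAdef, conjTranspose_smul, Matrix.smul_mul, Matrix.mul_smul, smul_smul, Complex.star_def,
        Complex.conj_ofReal, h2, conjTranspose_mul, conjTranspose_conjTranspose, hGh, mul_smul,
        Matrix.mul_smul, Matrix.smul_mul]
      simp only [Matrix.mul_assoc]
    simp only [h]
    rw [← Finset.smul_sum, ← Matrix.sum_mul, ← Matrix.mul_sum, hqJ, Matrix.mul_smul,
      Matrix.smul_mul, smul_smul, inv_mul_cancel₀ (by exact_mod_cast hN'.ne'), one_smul]
    exact invSqrt_mul_self_mul_invSqrt_le hσ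
  have hB (π) : ‖(W * J π)ᵀ‖ ≤ 1 := norm_transpose_le_one <| (l2_opNorm_mul _ _).trans
    (mul_le_one₀ hW (norm_nonneg _) (norm_le_one_of_conjTranspose_mul_self_eq_one (hJ π)))
  obtain ⟨Λ, hΛ, hΛle⟩ := exists_isLOCC hN A hA (fun π => (W * J π)ᵀ) hB
  refine ⟨Real.logb_nonneg one_lt_two hN1, N, N, stdMaxEntangled N, Λ, ?_,
    isMaxEntangled_stdMaxEntangled N, hΛ, ?_⟩
  · rw [Real.rpow_logb two_pos (by norm_num) hN']
  have hpos : (Λ (proj φ)).PosSemidef := hΛ.posSemidef (posSemidef_vecMulVec_self_star _)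
  rw [fidelity_proj_sq hpos]
  refine le_trans ?_ (hΛle (coeffMatrix φ) (((√N)⁻¹ : ℝ) • (1 : Matrix (Fin N) (Fin N) ℂ)))
  set t : Equiv.Perm (Fin a) → ℂ :=
    fun π => (J π * (J π)ᴴ * (G * coeffMatrix φ * W)).trace with ht
  have hterm (π) : ‖(A π * coeffMatrix φ * ((W * J π)ᵀ)ᵀ *
      (((√N)⁻¹ : ℝ) • (1 : Matrix (Fin N) (Fin N) ℂ))ᴴ).trace‖ ^ 2
        = q π * ‖(N : ℂ)⁻¹ * t π‖ ^ 2 := by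
    have h2 : ((J π)ᴴ * G * coeffMatrix φ * (W * J π)).trace = t π := by
      simp only [ht, Matrix.mul_assoc]
      rw [trace_mul_comm (J π)]
      simp only [Matrix.mul_assoc]
    rw [transpose_transpose, conjTranspose_smul, conjTranspose_one, Matrix.mul_smul,
      Matrix.mul_one, trace_smul, hAdef, Matrix.smul_mul, Matrix.smul_mul, trace_smul, h2,
      star_trivial]
    simp only [norm_smul, norm_mul, norm_inv, Complex.norm_natCast, Complex.norm_real, mul_pow,
      Real.norm_eq_abs, sq_abs, inv_pow]
    rw [Real.sq_sqrt hN'.le, Real.sq_sqrt (div_nonneg (hq0 π) hN'.le)]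
    ring
  have hsum : ∑ π, (q π : ℂ) * ((N : ℂ)⁻¹ * t π) = (CFC.sqrt σ * coeffMatrix φ * W).trace := by
    have h2 (π) : (q π : ℂ) * ((N : ℂ)⁻¹ * t π)
        = (N : ℂ)⁻¹ * (((q π : ℂ) • (J π * (J π)ᴴ)) * (G * coeffMatrix φ * W)).trace := by
      rw [Matrix.smul_mul, trace_smul, smul_eq_mul]
      ring
    simp only [h2]
    rw [← Finset.mul_sum, ← trace_sum, ← Matrix.sum_mul, hqJ, Matrix.smul_mul, trace_smul,
      smul_eq_mul, inv_mul_cancel_left₀ (by exact_mod_cast hN'.ne'), ← Matrix.mul_assoc,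
      ← Matrix.mul_assoc, hG, mul_invSqrt hσ]
  simp only [hterm]
  -- Jensen's inequality for the square of the norm.
  have hjensen : ‖∑ π, (q π : ℂ) * ((N : ℂ)⁻¹ * t π)‖ ^ 2
      ≤ ∑ π, q π * ‖(N : ℂ)⁻¹ * t π‖ ^ 2 := by
    refine le_trans ?_ (Real.pow_arith_mean_le_arith_mean_pow Finset.univ q
      (fun π => ‖(N : ℂ)⁻¹ * t π‖) (fun π _ => hq0 π) hq1 (fun π _ => norm_nonneg _) 2)
    gcongr
    refine (norm_sum_le _ _).trans (le_of_eq (Finset.sum_congr rfl fun π _ => ?_))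
    rw [norm_mul, Complex.norm_real, Real.norm_of_nonneg (hq0 π)]
  refine hF.trans (le_trans ?_ hjensen)
  rw [hsum, traceB_proj, ← hWF]
  exact sq_le_sq' (neg_le_of_abs_le (Complex.abs_re_le_norm _)) (Complex.re_le_norm _)

end Protocol

/-! ### Achievable rates -/

section Rates

variable {a b : ℕ}

/-- `M` is positive, and some maximally entangled state of rank `M` can be distilled from `φ` with
squared fidelity at least `1 - ε`. -/
def IsReachableRank (φ : BipVec a b) (ε : ℝ) (M : ℕ) : Prop :=
  0 < M ∧ ∃ (d : ℕ) (Ψ : BipVec d d) (Λ : BipOp a b →ₗ[ℂ] BipOp d d),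
    IsMaxEntangled M Ψ ∧ IsLOCC Λ ∧ 1 - ε ≤ fidelity (Λ (proj φ)) (proj Ψ) ^ 2

lemma isAchievableRate_iff {φ : BipVec a b} {ε R : ℝ} :
    IsAchievableRate φ ε R ↔ 0 ≤ R ∧ ∃ M, IsReachableRank φ ε M ∧ R ≤ Real.logb 2 M := by
  refine and_congr_right fun hR => ⟨?_, ?_⟩
  · rintro ⟨M, d, Ψ, Λ, hM, hΨ, hΛ, hF⟩
    have h0 : (0 : ℝ) < M := (Real.rpow_pos_of_pos two_pos R).trans_le hM
    exact ⟨M, ⟨by exact_mod_cast h0, d, Ψ, Λ, hΨ, hΛ, hF⟩,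
      (Real.le_logb_iff_rpow_le one_lt_two h0).mpr hM⟩
  · rintro ⟨M, ⟨h0, d, Ψ, Λ, hΨ, hΛ, hF⟩, hM⟩
    exact ⟨M, d, Ψ, Λ,
      (Real.le_logb_iff_rpow_le one_lt_two (by exact_mod_cast h0)).mp hM, hΨ, hΛ, hF⟩

lemma isAchievableRate_zero {φ : BipVec a b} (hφ : ‖φ‖ = 1) {ε : ℝ} (hε : 0 ≤ ε) :
    IsAchievableRate φ ε 0 := by
  have hρ := traceB_proj_posSemidef φ
  have hρ1 := trace_traceB_proj hφ
  have h := isAchievableRate_logb (φ := φ) (ε := ε) hρ hρ1 one_pos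
    (by simpa [hρ1] using norm_le_re_trace hρ) (by
      rw [fidelity_self hρ, hρ1, Complex.one_re]
      linarith)
  simpa using h

lemma isGreatest_distillableEntanglement {φ : BipVec a b} (hφ : ‖φ‖ = 1) {ε : ℝ} (hε : 0 ≤ ε)
    (hε1 : ε < 1) : IsGreatest (achievableRates φ ε) (distillableEntanglement φ ε) := by
  obtain ⟨-, M₁, hM₁, -⟩ := isAchievableRate_iff.mp (isAchievableRate_zero hφ hε)
  have hbdd : BddAbove {M | IsReachableRank φ ε M} := by
    refine ⟨⌊(a : ℝ) / (1 - ε) ^ 2⌋₊, ?_⟩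
    rintro M ⟨h0, d, Ψ, Λ, hΨ, hΛ, hF⟩
    exact Nat.le_floor (rank_le_of_fidelity hφ hε1 h0 hΨ hΛ hF)
  have hmax := Nat.sSup_mem ⟨M₁, hM₁⟩ hbdd
  set M₀ := sSup {M | IsReachableRank φ ε M} with hM₀
  have hge : (1 : ℝ) ≤ M₀ := by exact_mod_cast hmax.1
  have h : IsGreatest (achievableRates φ ε) ((Real.logb 2 M₀ : ℝ) : EReal) := by
    refine ⟨⟨_, isAchievableRate_iff.mpr
      ⟨Real.logb_nonneg one_lt_two hge, M₀, hmax, le_rfl⟩, rfl⟩, ?_⟩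
    rintro _ ⟨R, hR, rfl⟩
    obtain ⟨-, M, hM, hRM⟩ := isAchievableRate_iff.mp hR
    rw [EReal.coe_le_coe_iff]
    refine hRM.trans (Real.logb_le_logb_of_le one_lt_two (by exact_mod_cast hM.1) ?_)
    exact_mod_cast le_csSup hbdd hM
  rw [distillableEntanglement, h.isLUB.sSup_eq]
  exact h

lemma distillableEntanglement_le {φ : BipVec a b} (hφ : ‖φ‖ = 1) {ε : ℝ} (hε0 : 0 ≤ ε)
    (hε : ε < 1 / 4) : distillableEntanglement φ ε ≤
      ((smoothMinEntropy √(2 * √ε) (traceB (proj φ)) - Real.logb 2 (1 - 2 * √ε) : ℝ) : EReal) := by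
  refine sSup_le ?_
  rintro _ ⟨R, hR, rfl⟩
  obtain ⟨-, M, ⟨h0, d, Ψ, Λ, hΨ, hΛ, hF⟩, hRM⟩ := isAchievableRate_iff.mp hR
  rw [EReal.coe_le_coe_iff]
  exact hRM.trans (logb_rank_le_smoothMinEntropy hφ hε0 hε h0 hΨ hΛ hF)

lemma isLeast_sub_logb_floor {S : ℝ} (hS : 0 ≤ S) :
    0 < ⌊(2 : ℝ) ^ S⌋₊ ∧ S - Real.logb 2 ⌊(2 : ℝ) ^ S⌋₊ ≤ 1 ∧
      IsLeast {δ : ℝ | 0 ≤ δ ∧ ∃ N : ℕ, 0 < N ∧ S - δ = Real.logb 2 N}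
        (S - Real.logb 2 ⌊(2 : ℝ) ^ S⌋₊) := by
  have h1 : (1 : ℝ) ≤ 2 ^ S := Real.one_le_rpow one_lt_two.le hS
  set N := ⌊(2 : ℝ) ^ S⌋₊ with hN
  have hpos : 0 < N := Nat.floor_pos.mpr h1
  have hpos' : (1 : ℝ) ≤ N := by exact_mod_cast hpos
  have hle : (N : ℝ) ≤ 2 ^ S := Nat.floor_le (by positivity)
  have hlt : (2 : ℝ) ^ S < N + 1 := Nat.lt_floor_add_one _
  refine ⟨hpos, ?_, ⟨?_, N, hpos, by ring⟩, ?_⟩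
  · have h2 : Real.logb 2 (2 ^ S) ≤ Real.logb 2 (2 * N) :=
      Real.logb_le_logb_of_le one_lt_two (by positivity) (by linarith)
    rw [Real.logb_rpow two_pos (by norm_num), Real.logb_mul two_ne_zero (by positivity),
      Real.logb_self_eq_one one_lt_two] at h2
    linarith
  · have h2 := Real.logb_le_logb_of_le one_lt_two (by positivity) hle
    rw [Real.logb_rpow two_pos (by norm_num)] at h2
    linarith
  · rintro δ ⟨hδ, N', hN', hSδ⟩
    have hN'0 : (0 : ℝ) < N' := by exact_mod_cast hN'
    have h2 : (N' : ℝ) ≤ 2 ^ S := by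
      rw [← Real.logb_le_iff_le_rpow one_lt_two hN'0]
      linarith
    have h3 : (N' : ℝ) ≤ N := by exact_mod_cast Nat.le_floor h2
    have h4 := Real.logb_le_logb_of_le one_lt_two hN'0 h3
    linarith

lemma smoothMinEntropy_nonneg {φ : BipVec a b} (hφ : ‖φ‖ = 1) (ε : ℝ) :
    0 ≤ smoothMinEntropy ε (traceB (proj φ)) := by
  obtain ⟨⟨σ, ⟨hσ, hσ1, -⟩, hS⟩, -⟩ :=
    isGreatest_smoothMinEntropy (traceB_proj_posSemidef φ) (trace_traceB_proj hφ) ε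
  rw [← hS, minEntropy_eq hσ, neg_nonneg]
  refine Real.logb_nonpos one_lt_two (norm_nonneg _) ?_
  simpa [hσ1] using norm_le_re_trace hσ

lemma isAchievableRate_logb_floor {φ : BipVec a b} (hφ : ‖φ‖ = 1) {ε : ℝ} (hε : 0 ≤ ε) :
    IsAchievableRate φ ε
      (Real.logb 2 ⌊(2 : ℝ) ^ smoothMinEntropy ε (traceB (proj φ))⌋₊) := by
  obtain ⟨⟨σ, ⟨hσ, hσ1, hF⟩, hS⟩, -⟩ :=
    isGreatest_smoothMinEntropy (traceB_proj_posSemidef φ) (trace_traceB_proj hφ) ε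
  have hpos := (isLeast_sub_logb_floor (smoothMinEntropy_nonneg hφ ε)).1
  have hnorm := norm_pos_of_trace_eq_one hσ1
  refine isAchievableRate_logb hσ hσ1 hpos ?_ ?_
  · rw [le_inv_comm₀ hnorm (by exact_mod_cast hpos)]
    refine (Nat.floor_le (by positivity)).trans (le_of_eq ?_)
    rw [← hS, minEntropy_eq hσ, Real.rpow_neg two_pos.le,
      Real.rpow_logb two_pos (by norm_num) hnorm]
  -- The squared fidelity is at least `1 - ε²`; for `ε ≥ 1` there is nothing to reach.
  · rcases le_total ε 1 with h | h
    · nlinarith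
    · nlinarith [sq_nonneg (fidelity (traceB (proj φ)) σ)]

end Rates

end OneShot

theorem theorem1 {a b : ℕ} (φ : OneShot.BipVec a b) (hφ : ‖φ‖ = 1) (ε : ℝ) (hε : 0 ≤ ε) :
    -- the maximum defining the smoothed min-entropy exists, for every smoothing parameter
    (∀ δ : ℝ, 0 ≤ δ →
      IsGreatest
        (OneShot.minEntropy '' OneShot.stateBall (OneShot.traceB (OneShot.proj φ)) δ)
        (OneShot.smoothMinEntropy δ (OneShot.traceB (OneShot.proj φ)))) ∧
    -- the maximum defining the distillable entanglement exists
    (ε < 1 → IsGreatest (OneShot.achievableRates φ ε) (OneShot.distillableEntanglement φ ε)) ∧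
    -- the lower bound, with the least correction that makes it the logarithm of an integer
    (∃ Δ : ℝ, 0 ≤ Δ ∧ Δ ≤ 1 ∧
      IsLeast {δ : ℝ | 0 ≤ δ ∧ ∃ N : ℕ, 0 < N ∧
        OneShot.smoothMinEntropy ε (OneShot.traceB (OneShot.proj φ)) - δ = Real.logb 2 N} Δ ∧
      ((OneShot.smoothMinEntropy ε (OneShot.traceB (OneShot.proj φ)) - Δ : ℝ) : EReal) ≤
        OneShot.distillableEntanglement φ ε) ∧
    -- the upper bound
    (ε < 1 / 4 →
      OneShot.distillableEntanglement φ ε ≤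
        ((OneShot.smoothMinEntropy (Real.sqrt (2 * Real.sqrt ε))
            (OneShot.traceB (OneShot.proj φ)) -
          Real.logb 2 (1 - 2 * Real.sqrt ε) : ℝ) : EReal)) := by
  have hleast := OneShot.isLeast_sub_logb_floor (OneShot.smoothMinEntropy_nonneg hφ ε)
  refine ⟨fun δ _ => OneShot.isGreatest_smoothMinEntropy (OneShot.traceB_proj_posSemidef φ)
    (OneShot.trace_traceB_proj hφ) δ,
    OneShot.isGreatest_distillableEntanglement hφ hε,
    ⟨_, hleast.2.2.1.1, hleast.2.1, hleast.2.2, ?_⟩,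
    OneShot.distillableEntanglement_le hφ hε⟩
  rw [sub_sub_cancel]
  exact le_sSup ⟨_, OneShot.isAchievableRate_logb_floor hφ hε, rfl⟩
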